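/- Let $X$ be a smooth algebraic variety of dimension $n$ over $\mathbb{C}$: a scheme over $\mathbb{C}$ (not necessarily separated or quasi-compact) in which every point has an affine open neighborhood $\operatorname{Spec} A$ with $A$ a finitely generated reduced $\mathbb{C}$-algebra such that $\dim_{\mathbb{C}} \mathfrak{m}/\mathfrak{m}^2 = n$ for every maximal ideal $\mathfrak{m}$ of $A$. For $U \subset X$ open and $m \ge 0$, let $F_m D_X(U)$ be the set of linear differential operators on $U$ of order $\le m$, i.e. of the $\mathbb{C}$-linear endomorphisms $P = (P_V)_{V \subset U}$ of the sheaf $\mathcal{O}_U = \mathcal{O}_X|_U$ such that $$[f_0, [f_1, [\cdots, [f_m, P_V] \cdots ]]] = 0 \quad \text{for all open } V \subset U \text{ and all } f_0, \dots, f_m \in \mathcal{O}_X(V).$$ It is a left $\mathcal{O}_X(U)$-module, functions acting on $\mathcal{O}_U$ by multiplication. A vector field on $U$ is a $\mathbb{C}$-linear derivation of the sheaf $\mathcal{O}_U$. **Lemma.** Every point $p \in X$ has an affine open neighborhood $U$ with functions $x_1, \dots, x_n \in \mathcal{O}_X(U)$ and vector fields $\partial_1, \dots, \partial_n$ on $U$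 such that $$[\partial_i, \partial_j] = 0, \qquad [\partial_i, x_j] = \delta_{ij} \qquad (1 \le i, j \le n),$$ and, for every $m \ge 0$, $$F_m D_X(U) = \bigoplus_{|\alpha| \le m} \mathcal{O}_X(U)\, \partial^\alpha ,$$ that is, $F_m D_X(U)$ is a free left $\mathcal{O}_X(U)$-module with basis the operators $\partial^\alpha = \partial_1^{\alpha_1} \cdots \partial_n^{\alpha_n}$, where $\alpha \in \mathbb{Z}_{\ge 0}^n$ and $|\alpha| = \sum_i \alpha_i \le m$. -/

import Mathlib

open AlgebraicGeometry CategoryTheory Opposite TopologicalSpace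

noncomputable section

/-- A finitely generated reduced `ℂ`-algebra `A` such that `dim_ℂ 𝔪/𝔪² = n` for every
maximal ideal `𝔪`: the coordinate ring of a smooth `n`-dimensional affine variety. -/
structure IsSmoothAffineAlgebra (n : ℕ) (A : Type) [CommRing A] [Algebra ℂ A] : Prop where
  finiteType : Algebra.FiniteType ℂ A
  reduced : IsReduced A
  finrank_cotangent : ∀ 𝔪 : Ideal A, 𝔪.IsMaximal → Module.finrank ℂ 𝔪.Cotangent = n

namespace ComplexScheme

variable {X : Scheme.{0}} [X.Over (Spec (CommRingCat.of ℂ))]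

/-- The map `ℂ → 𝒪(U)` induced by the structure morphism `X → Spec ℂ`. -/
def constMap (U : X.Opens) : CommRingCat.of ℂ ⟶ Γ(X, U) :=
  (Scheme.ΓSpecIso (CommRingCat.of ℂ)).inv ≫
    (X ↘ Spec (CommRingCat.of ℂ)).appLE ⊤ U (le_top.trans_eq (Scheme.Hom.preimage_top _).symm)

theorem constMap_map {W V : X.Opens} (h : W ≤ V) :
    constMap V ≫ X.presheaf.map (homOfLE h).op = constMap W := by
  simp only [constMap, Category.assoc, Scheme.Hom.appLE_map]

/-- The `ℂ`-algebra structure on sections of the structure sheaf of a scheme over `ℂ`. -/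
instance sectionsAlgebra (U : X.Opens) : Algebra ℂ Γ(X, U) :=
  (constMap U).hom.toAlgebra

variable (X) in
/-- A smooth algebraic variety of dimension `n` over `ℂ` (not necessarily separated or
quasi-compact): every point has an affine open neighborhood which is a smooth affine variety
of dimension `n`. -/
class IsSmoothVariety (n : ℕ) : Prop where
  exists_affine : ∀ p : X, ∃ U : X.Opens, IsAffineOpen U ∧ p ∈ U ∧
    IsSmoothAffineAlgebra n Γ(X, U)

/-- The restriction map `𝒪(V) → 𝒪(W)` for `W ≤ V`. -/
def res {W V : X.Opens} (h : W ≤ V) : Γ(X, V) →ₐ[ℂ] Γ(X, W) where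
  __ := (X.presheaf.map (homOfLE h).op).hom
  commutes' c := congrArg (fun φ => φ.hom c) (constMap_map h)

/-- `End_ℂ(𝒪_U)`: the `ℂ`-algebra of `ℂ`-linear endomorphisms of the sheaf `𝒪_U = 𝒪_X|_U`,
that is, of families of `ℂ`-linear maps `P_V : 𝒪(V) → 𝒪(V)`, `V` open in `U`,
compatible with restrictions. Multiplication is composition. -/
def SheafEnd (U : X.Opens) :
    Subalgebra ℂ ((V : Set.Iic U) → Module.End ℂ Γ(X, V.1)) where
  carrier := {P | ∀ (V W : Set.Iic U) (h : W.1 ≤ V.1) (f : Γ(X, V.1)),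
    res h (P V f) = P W (res h f)}
  mul_mem' {P Q} hP hQ V W h f := by
    simp only [Pi.mul_apply, Module.End.mul_apply]
    rw [hP V W h, hQ V W h]
  add_mem' {P Q} hP hQ V W h f := by
    simp only [Pi.add_apply, LinearMap.add_apply, map_add]
    rw [hP V W h, hQ V W h]
  algebraMap_mem' c V W h f := by
    simp [Pi.algebraMap_apply, Module.algebraMap_end_apply]

/-- A function `a ∈ 𝒪(U)` as an endomorphism of `𝒪_U`: on `𝒪(V)` it is multiplication by
the restriction of `a` to `V`. -/
def mulOp (U : X.Opens) : Γ(X, U) →+* SheafEnd U where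
  toFun a := ⟨fun V => LinearMap.mulLeft ℂ (res V.2 a), fun V W h f => by
    have : res h (res V.2 a) = res W.2 a := by
      change (X.presheaf.map _ ≫ X.presheaf.map _).hom a = (X.presheaf.map _).hom a
      rw [← Functor.map_comp]
      rfl
    simp [this]⟩
  map_one' := by
    ext V f
    simp
  map_mul' a b := by
    ext V f
    simp
  map_zero' := by
    ext V f
    simp
  map_add' a b := by
    ext V f
    simp [add_mul]

/-- The (left) `𝒪(U)`-module structure of `End_ℂ(𝒪_U)`: `a • P = a ∘ P`. -/
instance sheafEndModule (U : X.Opens) : Module Γ(X, U) (SheafEnd U) :=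
  Module.compHom (SheafEnd U) (mulOp U)

/-- A vector field on `U`: an endomorphism of `𝒪_U` that is a `ℂ`-derivation of `𝒪(V)`
for every open `V` in `U`. -/
def IsVectorField {U : X.Opens} (P : SheafEnd U) : Prop :=
  ∀ (V : Set.Iic U) (f g : Γ(X, V.1)), P.1 V (f * g) = f * P.1 V g + g * P.1 V f

/-- `[f₀, [f₁, [⋯, [f_k, P]⋯]]]` for a list `f₀, …, f_k` of elements of a commutative
`ℂ`-algebra `A` and `P ∈ End_ℂ(A)`. -/
def iteratedAd {A : Type} [CommRing A] [Algebra ℂ A] (fs : List A) (P : Module.End ℂ A) :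
    Module.End ℂ A :=
  fs.foldr (fun f Q => ⁅LinearMap.mulLeft ℂ f, Q⁆) P

theorem iteratedAd_zero {A : Type} [CommRing A] [Algebra ℂ A] (fs : List A) :
    iteratedAd fs (0 : Module.End ℂ A) = 0 := by
  induction fs with
  | nil => rfl
  | cons f fs ih =>
    change ⁅LinearMap.mulLeft ℂ f, iteratedAd fs 0⁆ = 0
    rw [ih, Ring.lie_def, mul_zero, zero_mul, sub_zero]

theorem iteratedAd_add {A : Type} [CommRing A] [Algebra ℂ A] (fs : List A)
    (P Q : Module.End ℂ A) :
    iteratedAd fs (P + Q) = iteratedAd fs P + iteratedAd fs Q := by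
  induction fs with
  | nil => rfl
  | cons f fs ih =>
    change ⁅LinearMap.mulLeft ℂ f, iteratedAd fs (P + Q)⁆ =
      ⁅LinearMap.mulLeft ℂ f, iteratedAd fs P⁆ + ⁅LinearMap.mulLeft ℂ f, iteratedAd fs Q⁆
    simp only [ih, Ring.lie_def, mul_add, add_mul]
    abel

theorem iteratedAd_mulLeft_mul {A : Type} [CommRing A] [Algebra ℂ A] (fs : List A)
    (a : A) (P : Module.End ℂ A) :
    iteratedAd fs (LinearMap.mulLeft ℂ a * P) = LinearMap.mulLeft ℂ a * iteratedAd fs P := by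
  induction fs with
  | nil => rfl
  | cons f fs ih =>
    change ⁅LinearMap.mulLeft ℂ f, iteratedAd fs (LinearMap.mulLeft ℂ a * P)⁆ =
      LinearMap.mulLeft ℂ a * ⁅LinearMap.mulLeft ℂ f, iteratedAd fs P⁆
    rw [ih]
    ext g
    simp only [Ring.lie_def, LinearMap.sub_apply, Module.End.mul_apply,
      LinearMap.mulLeft_apply]
    ring

/-- `F_m D_X(U)`: the `𝒪(U)`-module of linear differential operators on `U` of order not
greater than `m`, i.e. of those `P ∈ End_ℂ(𝒪_U)` such that
`[f₀, [f₁, [⋯, [f_m, P_V]⋯]]] = 0` for all open `V` in `U` and all `f₀, …, f_m ∈ 𝒪(V)`. -/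
def diffOp (m : ℕ) (U : X.Opens) : Submodule Γ(X, U) (SheafEnd U) where
  carrier := {P | ∀ (V : Set.Iic U) (fs : List Γ(X, V.1)), fs.length = m + 1 →
    iteratedAd fs (P.1 V) = 0}
  add_mem' {P Q} hP hQ V fs h := by
    change iteratedAd fs (P.1 V + Q.1 V) = 0
    rw [iteratedAd_add, hP V fs h, hQ V fs h, add_zero]
  zero_mem' V fs _ := iteratedAd_zero fs
  smul_mem' a P hP V fs h := by
    change iteratedAd fs (LinearMap.mulLeft ℂ (res V.2 a) * P.1 V) = 0
    rw [iteratedAd_mulLeft_mul, hP V fs h, mul_zero]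

/-- `∂^α = ∂₁^{α₁} ⋯ ∂ₙ^{αₙ}`. -/
def monomialOp {U : X.Opens} {n : ℕ} (D : Fin n → SheafEnd U) (α : Fin n → ℕ) : SheafEnd U :=
  (List.ofFn fun i => D i ^ α i).prod

end ComplexScheme

end

/-! Near a point, choose functions `x i` whose differentials are a basis of Ω. The dual derivations
commute, because their brackets are derivations killing every `x i`. Such functions come from a
basis of the cotangent space at a closed point: Nakayama makes their differentials generate Ω nearby
(`AlgHom.exists_smul_mem_span_D`). The coefficients of a relation vanish at every nearby closed
point, since all cotangent spaces have dimension n; as the algebra is reduced and Jacobson, they are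
zero near the point. For the order filtration, bracketing with `x i` lowers the order by one and
acts on ∂^α as the partial derivative in ∂ᵢ. In characteristic zero this gives independence by
induction on degree. For spanning, an alternating Taylor series in ∂ᵢ turns an operator P into one
commuting with `x i`, and changes it only by terms covered by induction on the order. Once all
indices are treated, the remainder commutes with every `x i`, hence is a function
(`IsDiffOp.eq_mul_apply_one`). `IsWeylSystem.monomialSpan_eq` isolates this argument from the sheaf.
Statements about arbitrary opens are checked or glued on basic opens of U, where sections are
localizations. -/

noncomputable section

/-! ### Differentials and cotangent spaces at rational points. -/

section Cotangent

/-- Weak Nullstellensatz: a maximal ideal of a finitely generated algebra over an algebraically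
closed field is the kernel of a rational point. -/
theorem Ideal.IsMaximal.exists_algHom_ker_eq (k : Type*) {A : Type*} [Field k] [IsAlgClosed k]
    [CommRing A] [Algebra k A] [Algebra.FiniteType k A] (𝔪 : Ideal A) [𝔪.IsMaximal] :
    ∃ σ : A →ₐ[k] k, RingHom.ker σ = 𝔪 := by
  let _ := Ideal.Quotient.field 𝔪
  have : Module.Finite k (A ⧸ 𝔪) := finite_of_finite_type_of_isJacobsonRing k (A ⧸ 𝔪)
  have hb : Function.Bijective (algebraMap k (A ⧸ 𝔪)) :=
    IsAlgClosed.algebraMap_bijective_of_isIntegral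
  let e : k ≃ₐ[k] A ⧸ 𝔪 := AlgEquiv.ofBijective (Algebra.ofId k (A ⧸ 𝔪)) hb
  refine ⟨(e.symm : A ⧸ 𝔪 →ₐ[k] k).comp (Ideal.Quotient.mkₐ k 𝔪), ?_⟩
  ext a
  simp [RingHom.mem_ker, Ideal.Quotient.eq_zero_iff_mem]

variable {k A : Type*} [Field k] [CommRing A] [Algebra k A] (σ : A →ₐ[k] k)

theorem AlgHom.sub_algebraMap_mem_ker (a : A) : a - algebraMap k A (σ a) ∈ RingHom.ker σ := by
  simp [RingHom.mem_ker]

theorem AlgHom.smul_cotangent_ker (a : A) (v : (RingHom.ker σ).Cotangent) : a • v = σ a • v := by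
  obtain ⟨y, rfl⟩ := Ideal.toCotangent_surjective _ v
  rw [← sub_eq_zero, ← algebraMap_smul A (σ a), ← sub_smul, ← map_smul,
    Ideal.toCotangent_eq_zero, pow_two]
  exact Ideal.mul_mem_mul (σ.sub_algebraMap_mem_ker a) y.2

/-- The derivation `a ↦ [a - a(p)]` from `A` to the cotangent space at a rational point `p`. -/
def AlgHom.cotangentDerivation : Derivation k A (RingHom.ker σ).Cotangent :=
  Derivation.mk'
    { toFun a := (RingHom.ker σ).toCotangent ⟨_, σ.sub_algebraMap_mem_ker a⟩
      map_add' a b := by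
        rw [← map_add]
        congr 1
        ext
        simp
        ring
      map_smul' c a := by
        rw [RingHom.id_apply, ← algebraMap_smul A c ((RingHom.ker σ).toCotangent _),
          ← map_smul (RingHom.ker σ).toCotangent]
        congr 1
        ext
        simp [Algebra.smul_def, mul_sub] }
    fun a b => by
      rw [LinearMap.coe_mk, AddHom.coe_mk, ← map_smul, ← map_smul, ← map_add, ← sub_eq_zero,
        ← map_sub, Ideal.toCotangent_eq_zero, pow_two]
      convert neg_mem (Ideal.mul_mem_mul (σ.sub_algebraMap_mem_ker a) (σ.sub_algebraMap_mem_ker b))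
        using 1
      simp
      ring

theorem AlgHom.cotangentDerivation_apply {y : A} (hy : y ∈ RingHom.ker σ) :
    σ.cotangentDerivation y = (RingHom.ker σ).toCotangent ⟨y, hy⟩ := by
  change (RingHom.ker σ).toCotangent _ = _
  congr 1
  ext
  simp [(RingHom.mem_ker).1 hy]

open KaehlerDifferential

/-- If `f Ω` is spanned by `dx₁, …, dxₙ` and the cotangent space at a point where `f ≠ 0` has
dimension `n`, then the coefficients of any relation between the `dxᵢ` vanish at that point. -/
theorem AlgHom.map_eq_zero_of_sum_smul_D_eq_zero {n : ℕ}
    (hn : Module.finrank k (RingHom.ker σ).Cotangent = n) {f : A} (hf : σ f ≠ 0) {x : Fin n → A}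
    (hx : ∀ ω : Ω[A⁄k], f • ω ∈ Submodule.span A (Set.range fun i => D k A (x i)))
    {a : Fin n → A} (ha : ∑ i, a i • D k A (x i) = 0) (i : Fin n) : σ (a i) = 0 := by
  let δ := σ.cotangentDerivation
  let L := δ.liftKaehlerDifferential
  have hL (b : A) : L (D k A b) = δ b := δ.liftKaehlerDifferential_comp_D b
  have hspan : ⊤ ≤ Submodule.span k (Set.range fun i => δ (x i)) := by
    rintro v -
    obtain ⟨y, rfl⟩ := Ideal.toCotangent_surjective _ v
    rw [← AlgHom.cotangentDerivation_apply σ y.2]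
    obtain ⟨c, hc⟩ := (Submodule.mem_span_range_iff_exists_fun A).1 (hx (D k A y))
    have h := congrArg L hc
    simp only [map_sum, map_smul, hL] at h
    -- On the cotangent space `f` acts as the nonzero scalar `σ f`, so it can be cancelled.
    rw [← (Submodule.span k _).smul_mem_iff hf, ← σ.smul_cotangent_ker]
    change f • δ y ∈ _
    rw [← h]
    refine Submodule.sum_mem _ fun i _ => ?_
    rw [σ.smul_cotangent_ker]
    exact Submodule.smul_mem _ _ (Submodule.subset_span ⟨i, rfl⟩)
  have hli := linearIndependent_of_top_le_span_of_card_eq_finrank hspan (by simp [hn])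
  refine Fintype.linearIndependent_iff.1 hli (fun i => σ (a i)) ?_ i
  have h := congrArg L ha
  simpa only [map_sum, map_smul, hL, map_zero, σ.smul_cotangent_ker] using h

/-- At a rational point whose cotangent space has dimension `n`, the differentials of some `n`
functions span `Ω` in a neighbourhood. -/
theorem AlgHom.exists_smul_mem_span_D [Algebra.FiniteType k A] {n : ℕ}
    (hn : Module.finrank k (RingHom.ker σ).Cotangent = n) :
    ∃ (f : A) (x : Fin n → A), σ f ≠ 0 ∧
      ∀ ω : Ω[A⁄k], f • ω ∈ Submodule.span A (Set.range fun i => D k A (x i)) := by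
  have : IsNoetherianRing A := Algebra.FiniteType.isNoetherianRing k A
  have hfinA : Module.Finite A (RingHom.ker σ).Cotangent :=
    Module.Finite.of_surjective _ (Ideal.toCotangent_surjective _)
  -- `A` acts through `σ`, so generators over `A` already generate over `k`.
  have hfin : Module.Finite k (RingHom.ker σ).Cotangent := by
    obtain ⟨s, hs⟩ := hfinA.fg_top
    refine ⟨s, eq_top_iff.2 fun v _ => ?_⟩
    have hv : v ∈ Submodule.span A (s : Set (RingHom.ker σ).Cotangent) := hs ▸ Submodule.mem_top
    induction hv using Submodule.span_induction with
    | mem w hw => exact Submodule.subset_span hw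
    | zero => exact zero_mem _
    | add v w _ _ h1 h2 => exact add_mem (h1 trivial) (h2 trivial)
    | smul a v _ h =>
      rw [σ.smul_cotangent_ker]
      exact Submodule.smul_mem _ _ (h trivial)
  let b := Module.finBasisOfFinrankEq k (RingHom.ker σ).Cotangent hn
  choose x hx using fun i => Ideal.toCotangent_surjective _ (b i)
  let N : Submodule A Ω[A⁄k] := Submodule.span A (Set.range fun i => D k A (x i : A))
  have hsq : ∀ z ∈ RingHom.ker σ ^ 2, D k A z ∈ RingHom.ker σ • (⊤ : Submodule A Ω[A⁄k]) := by
    intro z hz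
    rw [pow_two] at hz
    induction hz using Submodule.mul_induction_on' with
    | mem_mul_mem r hr s hs =>
      rw [Derivation.leibniz]
      exact add_mem (Submodule.smul_mem_smul hr trivial) (Submodule.smul_mem_smul hs trivial)
    | add u _ v _ h1 h2 => rw [map_add]; exact add_mem h1 h2
  have hker : ∀ y ∈ RingHom.ker σ, D k A y ∈ RingHom.ker σ • (⊤ : Submodule A Ω[A⁄k]) ⊔ N := by
    intro y hy
    let c := b.repr ((RingHom.ker σ).toCotangent ⟨y, hy⟩)
    -- Removing the linear part of `y` leaves an element of 𝔪², whose differential lies in 𝔪Ω.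
    have hz : y - ∑ i, c i • (x i : A) ∈ RingHom.ker σ ^ 2 := by
      have h0 : (RingHom.ker σ).toCotangent (⟨y, hy⟩ - ∑ i, algebraMap k A (c i) • x i) = 0 := by
        simp only [map_sub, map_sum, LinearMap.map_smul (RingHom.ker σ).toCotangent, hx]
        simp only [algebraMap_smul]
        rw [b.sum_repr, sub_self]
      rw [Ideal.toCotangent_eq_zero] at h0
      simpa [Algebra.smul_def] using h0
    have h1 := hsq _ hz
    rw [map_sub, map_sum] at h1
    rw [← sub_add_cancel (D k A y) (∑ i, D k A (c i • (x i : A)))]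
    refine add_mem (Submodule.mem_sup_left h1) (Submodule.mem_sup_right ?_)
    refine Submodule.sum_mem _ fun i _ => ?_
    rw [Derivation.map_smul, ← algebraMap_smul A]
    exact Submodule.smul_mem _ _ (Submodule.subset_span ⟨i, rfl⟩)
  have htop : (⊤ : Submodule A Ω[A⁄k]) ≤ RingHom.ker σ • ⊤ ⊔ N := by
    rw [← span_range_derivation k A, Submodule.span_le, span_range_derivation k A]
    rintro _ ⟨a, rfl⟩
    have := hker _ (σ.sub_algebraMap_mem_ker a)
    rwa [map_sub, Derivation.map_algebraMap, sub_zero] at this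
  -- Nakayama for Ω/N: some `f` congruent to 1 modulo 𝔪 kills the quotient, so `σ f = 1`.
  obtain ⟨f, hf, hfN⟩ := Submodule.exists_sub_one_mem_and_smul_eq_zero_of_fg_of_le_smul
    (RingHom.ker σ) (⊤ : Submodule A (Ω[A⁄k] ⧸ N)) Module.Finite.fg_top (by
      rintro v -
      obtain ⟨w, rfl⟩ := N.mkQ_surjective v
      obtain ⟨u, hu, v, hv, rfl⟩ := Submodule.mem_sup.1 (htop (trivial : w ∈ ⊤))
      rw [map_add, (Submodule.Quotient.mk_eq_zero N).2 hv |> (show N.mkQ v = 0 from ·), add_zero]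
      have := Submodule.mem_map_of_mem (f := N.mkQ) hu
      rw [Submodule.map_smul''] at this
      exact Submodule.smul_mono le_rfl le_top this)
  refine ⟨f, fun i => x i, ?_, fun ω => ?_⟩
  · intro h
    rw [RingHom.mem_ker, map_sub, h] at hf
    simp at hf
  · have := hfN (N.mkQ ω) trivial
    rw [← map_smul] at this
    exact (Submodule.Quotient.mk_eq_zero N).1 this

end Cotangent

/-! ### Derivations and differentials under localization. -/

section Localization

open KaehlerDifferential

/-- Applying Leibniz to b·s = a expresses s·d(b) through values on `A`, and s is a unit in `B`. -/
theorem Derivation.eq_of_eq_on_algebraMap {R A B N : Type*} [CommRing R] [CommRing A] [CommRing B]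
    [Algebra R A] [Algebra R B] [Algebra A B] [IsScalarTower R A B] (S : Submonoid A)
    [IsLocalization S B] [AddCommGroup N] [Module R N] [Module B N]
    {d d' : Derivation R B N} (h : ∀ a : A, d (algebraMap A B a) = d' (algebraMap A B a)) :
    d = d' := by
  ext b
  obtain ⟨⟨a, s⟩, hs⟩ := IsLocalization.surj S b
  have h1 := congrArg d hs
  have h2 := congrArg d' hs
  rw [Derivation.leibniz] at h1 h2
  rw [h, h a, ← h2] at h1
  have h3 := add_left_cancel h1
  exact (IsLocalization.map_units B s).smul_left_cancel.1 h3

/-- Ω of the localization is the localization of Ω, and `S` acts invertibly on the `B`-module `N`,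
so the linear map attached to `d` lifts. -/
theorem Derivation.exists_extend_localization {R A B N : Type*} [CommRing R] [CommRing A]
    [CommRing B] [Algebra R A] [Algebra R B] [Algebra A B] [IsScalarTower R A B] (S : Submonoid A)
    [IsLocalization S B] [AddCommGroup N] [Module R N] [Module A N] [Module B N]
    [IsScalarTower R A N] [IsScalarTower A B N] [IsScalarTower R B N] (d : Derivation R A N) :
    ∃ d' : Derivation R B N, ∀ a : A, d' (algebraMap A B a) = d a := by
  have hu (s : S) : IsUnit (algebraMap A (Module.End A N) s) := by
    rw [Module.End.isUnit_iff]
    obtain ⟨u, hu⟩ := IsLocalization.map_units B s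
    have h (v : N) : algebraMap A (Module.End A N) s v = u • v := by
      rw [Module.algebraMap_end_apply, ← algebraMap_smul B, ← hu, Units.smul_def]
    rw [show ⇑(algebraMap A (Module.End A N) s) = fun v => u • v from funext h]
    exact MulAction.bijective u
  let l : Ω[B⁄R] →ₗ[A] N :=
    IsLocalizedModule.lift S (KaehlerDifferential.map R R A B) d.liftKaehlerDifferential hu
  let l' : Ω[B⁄R] →ₗ[B] N := l.extendScalarsOfIsLocalization S B
  refine ⟨l'.compDer (D R B), fun a => ?_⟩
  change l (D R B (algebraMap A B a)) = d a
  rw [← KaehlerDifferential.map_D R R A B, IsLocalizedModule.lift_apply,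
    Derivation.liftKaehlerDifferential_comp_D]

/-- Étale coordinates: if `f Ω` is spanned by the `dxᵢ` and every relation between the `dxᵢ` is
killed by `f`, then the `dxᵢ` are a basis of `Ω` after inverting `f`. -/
theorem exists_derivations_of_away {k A B : Type*} [CommRing k] [CommRing A] [CommRing B]
    [Algebra k A] [Algebra k B] [Algebra A B] [IsScalarTower k A B] {n : ℕ} {f : A}
    [IsLocalization.Away f B] {x : Fin n → A}
    (hx : ∀ ω : Ω[A⁄k], f • ω ∈ Submodule.span A (Set.range fun i => D k A (x i)))
    (hli : ∀ a : Fin n → A, ∑ i, a i • D k A (x i) = 0 → ∀ i, f * a i = 0) :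
    Submodule.span B (Set.range fun i => D k B (algebraMap A B (x i))) = ⊤ ∧
    ∃ d : Fin n → Derivation k B B,
      ∀ i j, d i (algebraMap A B (x j)) = if i = j then 1 else 0 := by
  have hf : IsUnit (algebraMap A B f) := IsLocalization.Away.algebraMap_isUnit f
  have hsp : Submodule.span B (Set.range fun i => D k B (algebraMap A B (x i))) = ⊤ := by
    rw [eq_top_iff, ← span_range_map_derivation_of_isLocalization k A B (.powers f),
      Submodule.span_le]
    rintro _ ⟨a, rfl⟩
    obtain ⟨c, hc⟩ := (Submodule.mem_span_range_iff_exists_fun A).1 (hx (D k A a))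
    have h := congrArg (KaehlerDifferential.map k k A B) hc
    simp only [map_sum, map_smul, KaehlerDifferential.map_D] at h
    rw [SetLike.mem_coe, Function.comp_apply, KaehlerDifferential.map_D,
      ← Submodule.smul_mem_iff_of_isUnit _ hf, algebraMap_smul, ← h]
    refine Submodule.sum_mem _ fun i _ => ?_
    rw [← algebraMap_smul B]
    exact Submodule.smul_mem _ _ (Submodule.subset_span ⟨i, rfl⟩)
  have hB : LinearIndependent B (fun i => D k B (algebraMap A B (x i))) := by
    rw [Fintype.linearIndependent_iff]
    intro b hb i
    -- Clear denominators; the relation then holds over `A` after multiplication by a power `t` of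
    -- `f`. `hli` kills its coefficients up to `f`, and `f`, `t`, `s` are units in `B`.
    obtain ⟨s, hs⟩ := IsLocalization.exist_integer_multiples_of_finite (.powers f) b
    choose a ha using hs
    have h0 : KaehlerDifferential.map k k A B (∑ i, a i • D k A (x i)) = 0 := by
      simp only [map_sum, map_smul, KaehlerDifferential.map_D]
      have : ∀ i, a i • D k B (algebraMap A B (x i)) =
          (s : A) • b i • D k B (algebraMap A B (x i)) := fun i => by
        rw [← algebraMap_smul B (a i), ha, smul_assoc]
      simp only [this, ← Finset.smul_sum, hb, smul_zero]
    obtain ⟨t, ht⟩ := (IsLocalizedModule.eq_zero_iff (.powers f) _).1 h0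
    rw [Submonoid.smul_def, Finset.smul_sum] at ht
    simp only [smul_smul] at ht
    have h1 := congrArg (algebraMap A B) (hli _ ht i)
    rw [map_mul, map_mul, map_zero, hf.mul_right_eq_zero,
      (IsLocalization.map_units B t).mul_right_eq_zero, ha, Algebra.smul_def,
      (IsLocalization.map_units B s).mul_right_eq_zero] at h1
    exact h1
  refine ⟨hsp, ?_⟩
  let b := Module.Basis.mk hB hsp.ge
  refine ⟨fun i => (b.coord i).compDer (D k B), fun i j => ?_⟩
  have : b j = D k B (algebraMap A B (x j)) := Module.Basis.mk_apply _ _ _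
  change b.coord i (D k B (algebraMap A B (x j))) = _
  rw [← this, Module.Basis.coord_apply, b.repr_self, Finsupp.single_apply]
  simp [eq_comm]

end Localization

/-- On a smooth affine variety, every maximal ideal has a basic open neighbourhood with étale
coordinates. -/
theorem IsSmoothAffineAlgebra.exists_coordinates {n : ℕ} {A : Type} [CommRing A] [Algebra ℂ A]
    (hA : IsSmoothAffineAlgebra n A) (𝔪 : Ideal A) [h𝔪 : 𝔪.IsMaximal] :
    ∃ (f : A) (x : Fin n → A), f ∉ 𝔪 ∧
      (∀ ω : Ω[A⁄ℂ], f • ω ∈ Submodule.span A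
        (Set.range fun i => KaehlerDifferential.D ℂ A (x i))) ∧
      ∀ a : Fin n → A, ∑ i, a i • KaehlerDifferential.D ℂ A (x i) = 0 → ∀ i, f * a i = 0 := by
  have := hA.finiteType
  have := hA.reduced
  have : IsJacobsonRing A := isJacobsonRing_of_finiteType (A := ℂ)
  obtain ⟨σ, rfl⟩ := Ideal.IsMaximal.exists_algHom_ker_eq ℂ 𝔪
  obtain ⟨f, x, hf, hx⟩ := σ.exists_smul_mem_span_D (hA.finrank_cotangent _ h𝔪)
  refine ⟨f, x, hf, hx, fun a ha i => ?_⟩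
  -- In a reduced Jacobson ring, vanishing can be tested at all maximal ideals; where `f` vanishes,
  -- `f * a i` does too.
  have hbot : (⊥ : Ideal A).jacobson = ⊥ :=
    IsJacobsonRing.out ‹_› Ideal.isRadical_bot
  rw [← Ideal.mem_bot, ← hbot, Ideal.jacobson, Ideal.mem_sInf]
  rintro 𝔫 ⟨-, h𝔫⟩
  obtain ⟨τ, rfl⟩ := Ideal.IsMaximal.exists_algHom_ker_eq ℂ 𝔫
  rw [RingHom.mem_ker, map_mul, mul_eq_zero, or_iff_not_imp_left]
  intro hτ
  exact τ.map_eq_zero_of_sum_smul_D_eq_zero (hA.finrank_cotangent _ h𝔫) hτ hx ha i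

/-! ### Ordered monomials in commuting elements. -/

section OrderedMonomial

theorem Pi.induction_add_single {n : ℕ} {p : (Fin n → ℕ) → Prop} (zero : p 0)
    (add_single : ∀ α i, p α → p (α + Pi.single i 1)) (α : Fin n → ℕ) : p α := by
  induction h : ∑ i, α i generalizing α with
  | zero =>
    have : α = 0 := funext fun i => (Finset.sum_eq_zero_iff.1 h) i (Finset.mem_univ i)
    exact this ▸ zero
  | succ N ih =>
    obtain ⟨i, -, hi⟩ := Finset.exists_ne_zero_of_sum_ne_zero (h.trans_ne N.succ_ne_zero)
    have hα : α - Pi.single i 1 + Pi.single i 1 = α := by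
      ext j
      by_cases hj : j = i
      · subst hj; simp; omega
      · simp [hj]
    rw [← hα]
    refine add_single _ _ (ih _ ?_)
    rw [← hα] at h
    simp only [Pi.add_apply, Finset.sum_add_distrib, Finset.sum_pi_single', Finset.mem_univ,
      if_true] at h
    simpa using h

variable {R : Type*} [Ring R] {n : ℕ}

/-- The ordered monomial `D₁^α₁ ⋯ Dₙ^αₙ`. -/
def orderedMonomial (D : Fin n → R) (α : Fin n → ℕ) : R :=
  (List.ofFn fun i => D i ^ α i).prod

theorem orderedMonomial_zero (D : Fin n → R) : orderedMonomial D 0 = 1 := by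
  simp [orderedMonomial]

-- The subring generated by the `D i` is commutative, so the ordered product may be computed there
-- as a `Finset` product.
open scoped IsMulCommutative in
theorem orderedMonomial_add_single {D : Fin n → R} (hD : ∀ i j, D i * D j = D j * D i)
    (α : Fin n → ℕ) (i : Fin n) :
    orderedMonomial D (α + Pi.single i 1) = orderedMonomial D α * D i := by
  let S := Algebra.adjoin ℤ (Set.range D)
  have : IsMulCommutative S := Algebra.isMulCommutative_adjoin ℤ (by
    rintro _ ⟨i, rfl⟩ _ ⟨j, rfl⟩
    exact hD i j)
  let d (i : Fin n) : S := ⟨D i, Algebra.subset_adjoin ⟨i, rfl⟩⟩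
  have key (β : Fin n → ℕ) : orderedMonomial D β = S.val (∏ i, d i ^ β i) := by
    rw [← List.prod_ofFn, map_list_prod, List.map_ofFn]
    rfl
  rw [key, key]
  have : ∏ j, d j ^ (α + Pi.single i 1 : Fin n → ℕ) j = (∏ j, d j ^ α j) * d i := by
    simp only [Pi.add_apply, pow_add, Finset.prod_mul_distrib]
    congr 1
    rw [Finset.prod_eq_single i (fun j _ hj => by simp [hj]) (by simp)]
    simp
  rw [this, map_mul]
  rfl

end OrderedMonomial

/-! ### Algebra of the relations [Dᵢ, xⱼ] = δᵢⱼ: independence and spanning. -/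

section WeylSystem

variable {A R : Type*} [CommRing A] [Ring R] [Module A R] {n : ℕ}

/-- A left module structure on a ring `R` given by a ring homomorphism `ι : A → R`, with
elements `xᵢ` of `A` and commuting elements `Dᵢ` of `R` such that `[Dᵢ, xⱼ] = δᵢⱼ`. -/
structure IsWeylSystem (ι : A →+* R) (x : Fin n → A) (D : Fin n → R) : Prop where
  smul_eq : ∀ (a : A) (r : R), a • r = ι a * r
  comm : ∀ i j, D i * D j = D j * D i
  lie_eq : ∀ i j, ⁅D i, ι (x j)⁆ = if i = j then 1 else 0

namespace IsWeylSystem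

variable {ι : A →+* R} {x : Fin n → A} {D : Fin n → R} (h : IsWeylSystem ι x D)
include h

theorem smul_mul (a : A) (r s : R) : a • r * s = a • (r * s) := by
  rw [h.smul_eq, h.smul_eq, mul_assoc]

/-- The commutator `P ↦ [P, xᵢ]`. -/
def ad (i : Fin n) : R →ₗ[A] R where
  toFun P := ⁅P, ι (x i)⁆
  map_add' P Q := by
    simp only [Ring.lie_def]
    noncomm_ring
  map_smul' a P := by
    have : ι (x i) * (ι a * P) = ι a * (ι (x i) * P) := by
      rw [← mul_assoc, ← mul_assoc, ← map_mul, ← map_mul, mul_comm]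
    simp only [h.smul_eq, Ring.lie_def, RingHom.id_apply, this, mul_sub, mul_assoc]

theorem ad_apply (i : Fin n) (P : R) : h.ad i P = ⁅P, ι (x i)⁆ := rfl

theorem ad_mul (i : Fin n) (P Q : R) : h.ad i (P * Q) = h.ad i P * Q + P * h.ad i Q := by
  simp only [ad_apply, Ring.lie_def]
  noncomm_ring

theorem ad_one (i : Fin n) : h.ad i 1 = 0 := by
  simp [ad_apply, Ring.lie_def]

theorem ad_comm (i j : Fin n) (P : R) : h.ad i (h.ad j P) = h.ad j (h.ad i P) := by
  have : ι (x i) * ι (x j) = ι (x j) * ι (x i) := by rw [← map_mul, ← map_mul, mul_comm]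
  simp only [ad_apply, Ring.lie_def, sub_mul, mul_sub, mul_assoc, this]
  simp only [← mul_assoc, this]
  abel

theorem ad_pow (i : Fin n) (k : ℕ) : h.ad i (D i ^ (k + 1)) = (k + 1) • D i ^ k := by
  induction k with
  | zero => simp [ad_apply, h.lie_eq]
  | succ k ih =>
    rw [pow_succ, ad_mul, ih, ad_apply, h.lie_eq, if_pos rfl, smul_mul_assoc, ← pow_succ, mul_one]
    rw [succ_nsmul _ (k + 1)]

theorem ad_pow_of_ne {i j : Fin n} (hij : i ≠ j) (k : ℕ) : h.ad j (D i ^ k) = 0 := by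
  induction k with
  | zero => rw [pow_zero, ad_one]
  | succ k ih => rw [pow_succ, ad_mul, ih, ad_apply, h.lie_eq, if_neg hij, zero_mul, mul_zero,
      add_zero]

/-- `h.ad j` is a derivation with value δᵢⱼ on `D i`, hence a formal partial derivative. The
truncated subtraction is harmless: where it truncates, the factor `α j` is 0. -/
theorem ad_orderedMonomial (α : Fin n → ℕ) (j : Fin n) :
    h.ad j (orderedMonomial D α) = α j • orderedMonomial D (α - Pi.single j 1) := by
  induction α using Pi.induction_add_single with
  | zero => simp [orderedMonomial_zero, ad_one]
  | add_single α i ih =>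
    rw [orderedMonomial_add_single h.comm, ad_mul, ih, ad_apply, h.lie_eq, smul_mul_assoc,
      ← orderedMonomial_add_single h.comm]
    by_cases hij : i = j
    · subst hij
      have h1 : α + Pi.single i 1 - Pi.single i 1 = α := by ext; simp
      rw [if_pos rfl, mul_one, h1, Pi.add_apply, Pi.single_eq_same, succ_nsmul]
      congr 1
      rcases Nat.eq_zero_or_pos (α i) with h0 | h0
      · simp [h0]
      · congr 2
        ext j
        by_cases hj : j = i
        · subst hj; simp; omega
        · simp [hj]
    · rw [if_neg hij, mul_zero, add_zero, Pi.add_apply, Pi.single_eq_of_ne (Ne.symm hij), add_zero]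
      congr 2
      ext l
      by_cases hl : l = j
      · subst hl; simp [Ne.symm hij]
      · simp [hl]

/-- The operators `D^α` are linearly independent. -/
theorem linearIndependent [Algebra ℚ A] (hι : Function.Injective ι) :
    LinearIndependent A (orderedMonomial D) := by
  let Φ := Finsupp.linearCombination A (orderedMonomial D)
  -- The formal partial derivative on coefficient families, which `Φ` intertwines with `h.ad i`.
  let pd (i : Fin n) : ((Fin n → ℕ) →₀ A) →ₗ[A] ((Fin n → ℕ) →₀ A) :=
    Finsupp.linearCombination A fun α => Finsupp.single (α - Pi.single i 1) (α i : A)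
  have hpd (i : Fin n) (l) : Φ (pd i l) = h.ad i (Φ l) := by
    suffices Φ ∘ₗ pd i = h.ad i ∘ₗ Φ from LinearMap.congr_fun this l
    ext α
    simp [Φ, pd, ad_orderedMonomial, Nat.cast_smul_eq_nsmul]
  have hcoeff (i : Fin n) (l) (β : Fin n → ℕ) :
      pd i l β = (β i + 1 : ℕ) * l (β + Pi.single i 1) := by
    suffices Finsupp.lapply β ∘ₗ pd i =
        ((β i + 1 : ℕ) : A) • (Finsupp.lapply (β + Pi.single i 1) : _ →ₗ[A] A) from
      LinearMap.congr_fun this l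
    ext α
    by_cases hα : α = β + Pi.single i 1
    · subst hα
      simp [pd]
    · have : α i = 0 ∨ α - Pi.single i 1 ≠ β := by
        rw [or_iff_not_imp_left]
        rintro h0 rfl
        refine hα (funext fun j => ?_)
        by_cases hj : j = i
        · subst hj; simp; omega
        · simp [hj]
      rcases this with h0 | h0
      · simp [pd, h0, hα]
      · simp [pd, hα, h0]
  rw [linearIndependent_iff]
  suffices ∀ (N : ℕ) (l : (Fin n → ℕ) →₀ A), (∀ α, l α ≠ 0 → ∑ i, α i ≤ N) → Φ l = 0 → l = 0 from
    fun l hl => this (l.support.sup fun α => ∑ i, α i) l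
      (fun α hα => Finset.le_sup (f := fun α : Fin n → ℕ => ∑ i, α i)
        (Finsupp.mem_support_iff.2 hα)) hl
  have hconst (l : (Fin n → ℕ) →₀ A) (hl : ∀ α, α ≠ 0 → l α = 0) (h0 : Φ l = 0) : l = 0 := by
    have hs : l = Finsupp.single 0 (l 0) := by
      ext α
      by_cases hα : α = 0
      · simp [hα]
      · rw [hl α hα, Finsupp.single_eq_of_ne hα]
    rw [hs] at h0 ⊢
    have h1 : l 0 • (1 : R) = 0 := by
      simpa [Φ, orderedMonomial_zero] using h0
    rw [h.smul_eq, mul_one] at h1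
    rw [(map_eq_zero_iff ι hι).1 h1, Finsupp.single_zero]
  intro N
  induction N with
  | zero =>
    intro l hl h0
    refine hconst l (fun α hα => by_contra fun hne => hα ?_) h0
    exact funext fun i => Finset.sum_eq_zero_iff.1 (Nat.le_zero.1 (hl α hne)) i (Finset.mem_univ i)
  | succ N ih =>
    intro l hl h0
    refine hconst l (fun α hα => ?_) h0
    obtain ⟨i, hi⟩ := Function.ne_iff.1 hα
    -- Differentiating a relation gives one of lower degree, zero by induction. The coefficient at
    -- `α` is recovered from it by dividing by the positive integer `α i`.
    have hz : pd i l = 0 := by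
      refine ih _ (fun β hβ => ?_) (by rw [hpd, h0, map_zero])
      rw [hcoeff] at hβ
      have := hl _ (right_ne_zero_of_mul hβ)
      simp only [Pi.add_apply, Finset.sum_add_distrib, Finset.sum_pi_single', Finset.mem_univ,
        if_true] at this
      omega
    have h1 := hcoeff i l (α - Pi.single i 1)
    rw [hz, Finsupp.zero_apply] at h1
    have hα : α - Pi.single i 1 + Pi.single i 1 = α := by
      ext j
      by_cases hj : j = i
      · subst hj; simp at hi ⊢; omega
      · simp [hj]
    rw [hα] at h1
    have hu : IsUnit (((α - Pi.single i 1 : Fin n → ℕ) i + 1 : ℕ) : A) := by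
      rw [← map_natCast (algebraMap ℚ A)]
      exact (isUnit_iff_ne_zero.2 (by positivity)).map _
    exact hu.mul_right_eq_zero.1 h1.symm

/-- The span of the operators `D^α` with `|α| ≤ m`. -/
def monomialSpan (_ : IsWeylSystem ι x D) (m : ℕ) : Submodule A R :=
  Submodule.span A (Set.range fun α : {α : Fin n → ℕ // ∑ i, α i ≤ m} => orderedMonomial D α.1)

theorem orderedMonomial_mem {m : ℕ} (α : Fin n → ℕ) (hα : ∑ i, α i ≤ m) :
    orderedMonomial D α ∈ h.monomialSpan m :=
  Submodule.subset_span ⟨⟨α, hα⟩, rfl⟩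

theorem mul_mem_monomialSpan {m : ℕ} {P : R} (hP : P ∈ h.monomialSpan m) (i : Fin n) :
    P * D i ∈ h.monomialSpan (m + 1) := by
  induction hP using Submodule.span_induction with
  | mem P hP =>
    obtain ⟨⟨α, hα⟩, rfl⟩ := hP
    change orderedMonomial D α * D i ∈ _
    rw [← orderedMonomial_add_single h.comm]
    refine h.orderedMonomial_mem _ ?_
    simpa [Finset.sum_add_distrib] using hα
  | zero => rw [zero_mul]; exact zero_mem _
  | add P Q _ _ hP hQ => rw [add_mul]; exact add_mem hP hQ
  | smul a P _ hP => rw [h.smul_mul]; exact Submodule.smul_mem _ _ hP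

theorem mul_pow_mem_monomialSpan {m : ℕ} {P : R} (hP : P ∈ h.monomialSpan m) (i : Fin n) (k : ℕ) :
    P * D i ^ k ∈ h.monomialSpan (m + k) := by
  induction k with
  | zero => simpa using hP
  | succ k ih =>
    rw [pow_succ, ← mul_assoc, ← add_assoc]
    exact h.mul_mem_monomialSpan ih i

variable [Algebra ℚ A] {F : ℕ → Submodule A R}

/-- Subtracting a Taylor-like series from `P` makes it commute with `xᵢ`. -/
theorem ad_sum_eq_zero (i : Fin n) {m : ℕ} {P : R} (hP : (h.ad i)^[m + 1] P = 0) :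
    h.ad i (∑ k ∈ Finset.range (m + 1), algebraMap ℚ A ((-1) ^ k / k.factorial) •
      ((h.ad i)^[k] P * D i ^ k)) = 0 := by
  -- The sum telescopes: differentiating `D i ^ (k + 1)` cancels what term k leaves, so only the
  -- last term survives.
  suffices ∀ N, h.ad i (∑ k ∈ Finset.range (N + 1), algebraMap ℚ A ((-1) ^ k / k.factorial) •
      ((h.ad i)^[k] P * D i ^ k)) = algebraMap ℚ A ((-1) ^ N / N.factorial) •
        ((h.ad i)^[N + 1] P * D i ^ N) by
    rw [this, hP, zero_mul, smul_zero]
  intro N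
  induction N with
  | zero => simp
  | succ N ih =>
    rw [Finset.sum_range_succ, map_add, ih, map_smul, ad_mul, ad_pow,
      ← Function.iterate_succ_apply' (h.ad i), smul_add, mul_smul_comm,
      ← Nat.cast_smul_eq_nsmul A, smul_smul, add_left_comm, ← add_smul]
    have : algebraMap ℚ A ((-1) ^ N / N.factorial) +
        algebraMap ℚ A ((-1) ^ (N + 1) / (N + 1).factorial) * ((N + 1 : ℕ) : A) = 0 := by
      rw [← map_natCast (algebraMap ℚ A), ← map_mul, ← map_add, Nat.factorial_succ]
      convert map_zero (algebraMap ℚ A)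
      have := N.factorial_ne_zero
      push_cast
      field_simp
      ring
    rw [this, zero_smul, add_zero]

/-- Take the Taylor series of `ad_sum_eq_zero`. Its term k = 0 is `P`; for k > 0 the k-fold bracket
has order m - k < m, so `hspan` applies and the factor `D i ^ k` restores degree m. Commutation with
other `x j` survives since `h.ad j` commutes with `h.ad i` and kills `D i`. -/
theorem exists_ad_eq_zero {m : ℕ} (hspan : ∀ k < m, F k ≤ h.monomialSpan k)
    (hle : h.monomialSpan m ≤ F m)
    (hF_zero : ∀ P ∈ F 0, ∀ i, h.ad i P = 0)
    (hF_succ : ∀ m, ∀ P ∈ F (m + 1), ∀ i, h.ad i P ∈ F m)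
    {P : R} (hP : P ∈ F m) (i : Fin n) :
    ∃ E ∈ F m, P - E ∈ h.monomialSpan m ∧ h.ad i E = 0 ∧ ∀ j, h.ad j P = 0 → h.ad j E = 0 := by
  have hit : ∀ k ≤ m, (h.ad i)^[k] P ∈ F (m - k) := by
    intro k
    induction k with
    | zero => exact fun _ => hP
    | succ k ih =>
      intro hk
      rw [Function.iterate_succ_apply']
      refine hF_succ _ _ ?_ i
      rw [show m - (k + 1) + 1 = m - k by omega]
      exact ih (by omega)
  have htop : (h.ad i)^[m + 1] P = 0 := by
    rw [Function.iterate_succ_apply']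
    exact hF_zero _ (by simpa using hit m le_rfl) i
  set E := ∑ k ∈ Finset.range (m + 1), algebraMap ℚ A ((-1) ^ k / k.factorial) •
    ((h.ad i)^[k] P * D i ^ k) with hE
  have hi : h.ad i E = 0 := h.ad_sum_eq_zero i htop
  have hsub : P - E ∈ h.monomialSpan m := by
    rw [hE, Finset.sum_range_succ']
    simp only [Function.iterate_zero_apply, pow_zero, mul_one, Nat.factorial_zero, Nat.cast_one,
      div_one, map_one, one_smul]
    rw [add_comm, sub_add_cancel_left]
    refine neg_mem (Submodule.sum_mem _ fun k hk => Submodule.smul_mem _ _ ?_)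
    have hk := Finset.mem_range.1 hk
    have := h.mul_pow_mem_monomialSpan (hspan _ (by omega) (hit (k + 1) (by omega))) i (k + 1)
    rwa [Nat.sub_add_cancel (by omega)] at this
  refine ⟨E, ?_, hsub, hi, fun j hj => ?_⟩
  · rw [← sub_sub_cancel P E]
    exact sub_mem hP (hle hsub)
  · by_cases hij : i = j
    · exact hij ▸ hi
    · rw [hE, map_sum]
      refine Finset.sum_eq_zero fun k _ => ?_
      have : h.ad j ((h.ad i)^[k] P) = 0 := by
        rw [Function.Commute.iterate_right (f := h.ad j) (g := h.ad i) (h.ad_comm j i) k P, hj,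
          iterate_map_zero]
      rw [map_smul, ad_mul, this, h.ad_pow_of_ne hij, zero_mul, mul_zero, add_zero, smul_zero]

/-- A filtration of `R` which behaves like the order filtration of differential operators is
spanned by the `D^α`. -/
theorem monomialSpan_eq
    (hF_mono : ∀ m, F m ≤ F (m + 1))
    (hF_one : 1 ∈ F 0)
    (hF_mul : ∀ m, ∀ P ∈ F m, ∀ i, P * D i ∈ F (m + 1))
    (hF_zero : ∀ P ∈ F 0, ∀ i, ⁅P, ι (x i)⁆ = 0)
    (hF_succ : ∀ m, ∀ P ∈ F (m + 1), ∀ i, ⁅P, ι (x i)⁆ ∈ F m)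
    (hF_range : ∀ m, ∀ P ∈ F m, (∀ i, ⁅P, ι (x i)⁆ = 0) → P ∈ ι.range) (m : ℕ) :
    h.monomialSpan m = F m := by
  have hmono : Monotone F := monotone_nat_of_le_succ hF_mono
  have hmem (α : Fin n → ℕ) : orderedMonomial D α ∈ F (∑ i, α i) := by
    induction α using Pi.induction_add_single with
    | zero => simpa [orderedMonomial_zero] using hF_one
    | add_single α i ih =>
      rw [orderedMonomial_add_single h.comm]
      simpa [Finset.sum_add_distrib] using hF_mul _ _ ih i
  have hle (m : ℕ) : h.monomialSpan m ≤ F m := by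
    rw [monomialSpan, Submodule.span_le]
    rintro _ ⟨⟨α, hα⟩, rfl⟩
    exact hmono hα (hmem α)
  refine le_antisymm (hle m) ?_
  induction m using Nat.strong_induction_on with
  | _ m ih =>
    intro P hP
    -- Indices are treated one at a time; each correction preserves the commutations already
    -- achieved.
    have key (s : Finset (Fin n)) :
        ∃ E ∈ F m, P - E ∈ h.monomialSpan m ∧ ∀ i ∈ s, h.ad i E = 0 := by
      induction s using Finset.induction_on with
      | empty => exact ⟨P, hP, by simp, by simp⟩
      | insert i s _ ihs =>
        obtain ⟨E, hE, hPE, hs⟩ := ihs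
        obtain ⟨E', hE', hEE', hi, hj⟩ := h.exists_ad_eq_zero ih (hle m) hF_zero hF_succ hE i
        refine ⟨E', hE', ?_, ?_⟩
        · rw [← sub_add_sub_cancel P E E']
          exact add_mem hPE hEE'
        · intro j hjs
          rcases Finset.mem_insert.1 hjs with rfl | hjs
          · exact hi
          · exact hj j (hs j hjs)
    obtain ⟨E, hE, hPE, hs⟩ := key Finset.univ
    obtain ⟨a, ha⟩ := hF_range m E hE fun i => hs i (Finset.mem_univ i)
    rw [← sub_add_cancel P E]
    refine add_mem hPE ?_
    rw [← ha, ← mul_one (ι a), ← h.smul_eq, ← orderedMonomial_zero D]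
    exact Submodule.smul_mem _ _ (h.orderedMonomial_mem _ (by simp))

end IsWeylSystem

end WeylSystem

namespace ComplexScheme

/-! ### Differential operators on a commutative algebra. -/

section IsDiffOp

variable {A : Type} [CommRing A] [Algebra ℂ A]

/-- Differential operators of order at most `m` on an algebra. -/
def IsDiffOp (m : ℕ) (P : Module.End ℂ A) : Prop :=
  ∀ fs : List A, fs.length = m + 1 → iteratedAd fs P = 0

theorem isDiffOp_zero_iff {P : Module.End ℂ A} :
    IsDiffOp 0 P ↔ ∀ f : A, ⁅LinearMap.mulLeft ℂ f, P⁆ = 0 := by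
  refine ⟨fun h f => h [f] rfl, fun h fs hfs => ?_⟩
  obtain ⟨f, rfl⟩ := List.length_eq_one_iff.1 hfs
  exact h f

/-- The innermost bracket, given by the last entry of the list, is split off; this is the form
suited to induction on the order. -/
theorem isDiffOp_succ_iff {m : ℕ} {P : Module.End ℂ A} :
    IsDiffOp (m + 1) P ↔ ∀ f : A, IsDiffOp m ⁅LinearMap.mulLeft ℂ f, P⁆ := by
  have key (fs : List A) (f : A) :
      iteratedAd (fs ++ [f]) P = iteratedAd fs ⁅LinearMap.mulLeft ℂ f, P⁆ :=
    List.foldr_append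
  refine ⟨fun h f fs hfs => ?_, fun h fs hfs => ?_⟩
  · rw [← key]
    exact h _ (by simp [hfs])
  · obtain rfl | ⟨gs, f, rfl⟩ := fs.eq_nil_or_concat
    · simp at hfs
    · rw [List.concat_eq_append, key]
      exact h f gs (by simpa using hfs)

theorem IsDiffOp.succ {m : ℕ} {P : Module.End ℂ A} (h : IsDiffOp m P) : IsDiffOp (m + 1) P := by
  intro fs hfs
  obtain _ | ⟨f, gs⟩ := fs
  · simp at hfs
  · change ⁅LinearMap.mulLeft ℂ f, iteratedAd gs P⁆ = 0
    rw [h gs (by simpa using hfs), Ring.lie_def, mul_zero, zero_mul, sub_zero]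

theorem IsDiffOp.add {m : ℕ} {P Q : Module.End ℂ A} (hP : IsDiffOp m P) (hQ : IsDiffOp m Q) :
    IsDiffOp m (P + Q) := fun fs hfs => by
  rw [iteratedAd_add, hP fs hfs, hQ fs hfs, add_zero]

theorem IsDiffOp.neg {m : ℕ} {P : Module.End ℂ A} (hP : IsDiffOp m P) : IsDiffOp m (-P) := by
  intro fs hfs
  have : -P = LinearMap.mulLeft ℂ (-1) * P := by ext; simp
  rw [this, iteratedAd_mulLeft_mul, hP fs hfs, mul_zero]

theorem isDiffOp_one : IsDiffOp 0 (1 : Module.End ℂ A) :=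
  isDiffOp_zero_iff.2 fun f => by rw [Ring.lie_def, mul_one, one_mul, sub_self]

theorem IsDiffOp.mul_mulLeft {m : ℕ} {P : Module.End ℂ A} (h : IsDiffOp m P) (a : A) :
    IsDiffOp m (P * LinearMap.mulLeft ℂ a) := by
  have key (Q : Module.End ℂ A) (f : A) : ⁅LinearMap.mulLeft ℂ f, Q * LinearMap.mulLeft ℂ a⁆ =
      ⁅LinearMap.mulLeft ℂ f, Q⁆ * LinearMap.mulLeft ℂ a := by
    ext g
    simp [Ring.lie_def, mul_left_comm]
  induction m generalizing P with
  | zero =>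
    rw [isDiffOp_zero_iff] at h ⊢
    intro f
    rw [key, h, zero_mul]
  | succ m ih =>
    rw [isDiffOp_succ_iff] at h ⊢
    intro f
    rw [key]
    exact ih (h f)

theorem IsDiffOp.mul_derivation {m : ℕ} {P : Module.End ℂ A} (h : IsDiffOp m P)
    {d : Module.End ℂ A} (hd : ∀ f g, d (f * g) = f * d g + g * d f) :
    IsDiffOp (m + 1) (P * d) := by
  -- The first summand is handled by induction on the order; the second is `Q` composed with a
  -- function.
  have key (Q : Module.End ℂ A) (f : A) : ⁅LinearMap.mulLeft ℂ f, Q * d⁆ =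
      ⁅LinearMap.mulLeft ℂ f, Q⁆ * d + Q * LinearMap.mulLeft ℂ (-d f) := by
    ext g
    simp only [Ring.lie_def, LinearMap.sub_apply, LinearMap.add_apply, Module.End.mul_apply,
      LinearMap.mulLeft_apply, hd, map_add, neg_mul, map_neg, mul_comm g]
    ring
  induction m generalizing P with
  | zero =>
    rw [isDiffOp_succ_iff]
    intro f
    rw [key, isDiffOp_zero_iff.1 h, zero_mul, zero_add]
    exact h.mul_mulLeft _
  | succ m ih =>
    rw [isDiffOp_succ_iff]
    intro f
    rw [key]
    exact (ih (isDiffOp_succ_iff.1 h f)).add (h.mul_mulLeft _)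

/-- If a derivation is determined by its values on the `xᵢ`, then a differential operator
commuting with the `xᵢ` is a function. -/
theorem IsDiffOp.eq_mul_apply_one {m : ℕ} {P : Module.End ℂ A} (h : IsDiffOp m P) {ι : Type*}
    {x : ι → A} (hx : ∀ d : Derivation ℂ A A, (∀ i, d (x i) = 0) → d = 0)
    (hP : ∀ i g, P (x i * g) = x i * P g) (f : A) : P f = f * P 1 := by
  induction m generalizing P f with
  | zero =>
    have := LinearMap.congr_fun (isDiffOp_zero_iff.1 h f) 1
    exact (sub_eq_zero.1 (by simpa [Ring.lie_def] using this)).symm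
  | succ m ih =>
    -- The bracket [f, P] has lower order and still commutes with the `x i`, so by induction it is
    -- multiplication by its value at 1. This identity is the Leibniz rule for P - P(1).
    have key (f g : A) : f * P g - P (f * g) = g * (f * P 1 - P f) := by
      have := ih (isDiffOp_succ_iff.1 h f) (fun i g => by
        simp only [Ring.lie_def, LinearMap.sub_apply, Module.End.mul_apply,
          LinearMap.mulLeft_apply, mul_left_comm f, hP]
        ring) g
      simpa [Ring.lie_def] using this
    let d : Derivation ℂ A A := Derivation.mk' (P - LinearMap.mulRight ℂ (P 1)) fun a b => by
      simp only [LinearMap.sub_apply, LinearMap.mulRight_apply, smul_eq_mul]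
      linear_combination -key a b
    have h0 : d = 0 := hx d fun i => by
      have := hP i 1
      rw [mul_one] at this
      simp [d, this]
    exact sub_eq_zero.1 (DFunLike.congr_fun h0 f)

end IsDiffOp

/-! ### Basic opens of an affine open, and gluing along them. -/

variable {X : Scheme.{0}}

/-- `W` is a basic open subset of `U`. -/
def IsBasicOpenOf (U W : X.Opens) : Prop := ∃ f : Γ(X, U), W = X.basicOpen f

theorem IsBasicOpenOf.le {U W : X.Opens} (h : IsBasicOpenOf U W) : W ≤ U := by
  obtain ⟨f, rfl⟩ := h
  exact X.basicOpen_le f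

theorem IsBasicOpenOf.inf {U W W' : X.Opens} (h : IsBasicOpenOf U W) (h' : IsBasicOpenOf U W') :
    IsBasicOpenOf U (W ⊓ W') := by
  obtain ⟨f, rfl⟩ := h
  obtain ⟨g, rfl⟩ := h'
  exact ⟨f * g, (X.basicOpen_mul f g).symm⟩

/-- The basic open subsets of `U` contained in `V`. -/
abbrev BasicOpens (U V : X.Opens) := {W : X.Opens // IsBasicOpenOf U W ∧ W ≤ V}

theorem le_iSup_basicOpens {U V : X.Opens} (hU : IsAffineOpen U) (hV : V ≤ U) :
    V ≤ ⨆ W : BasicOpens U V, W.1 := by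
  intro p hp
  obtain ⟨f, hf, hpf⟩ := hU.exists_basicOpen_le ⟨p, hp⟩ (hV hp)
  exact Opens.mem_iSup.2 ⟨⟨_, ⟨f, rfl⟩, hf⟩, hpf⟩

variable [X.Over (Spec (CommRingCat.of ℂ))]

theorem res_res {W V V' : X.Opens} (h : W ≤ V) (h' : V ≤ V') (f : Γ(X, V')) :
    res h (res h' f) = res (h.trans h') f := by
  change (X.presheaf.map _ ≫ X.presheaf.map _).hom f = (X.presheaf.map _).hom f
  rw [← Functor.map_comp]
  rfl

theorem res_refl {V : X.Opens} (f : Γ(X, V)) : res le_rfl f = f := by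
  change (X.presheaf.map (𝟙 _)).hom f = f
  rw [X.presheaf.map_id]
  rfl

theorem eq_of_res_eq {U V : X.Opens} (hU : IsAffineOpen U) (hV : V ≤ U) {s t : Γ(X, V)}
    (h : ∀ W : BasicOpens U V, res W.2.2 s = res W.2.2 t) : s = t :=
  X.sheaf.eq_of_locally_eq' (fun W : BasicOpens U V => W.1) V (fun W => homOfLE W.2.2)
    (le_iSup_basicOpens hU hV) s t h

/-- Basic opens are stable under intersection, so compatibility along inclusions suffices. -/
theorem exists_gluing {U V : X.Opens} (hU : IsAffineOpen U) (hV : V ≤ U)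
    (s : ∀ W : BasicOpens U V, Γ(X, W.1))
    (hs : ∀ W W' : BasicOpens U V, ∀ h : W.1 ≤ W'.1, res h (s W') = s W) :
    ∃ t : Γ(X, V), ∀ W : BasicOpens U V, res W.2.2 t = s W := by
  obtain ⟨t, ht, -⟩ := X.sheaf.existsUnique_gluing' (fun W : BasicOpens U V => W.1) V
    (fun W => homOfLE W.2.2) (le_iSup_basicOpens hU hV) s (fun W W' => by
      let W₀ : BasicOpens U V := ⟨W.1 ⊓ W'.1, W.2.1.inf W'.2.1, inf_le_left.trans W.2.2⟩
      exact (hs W₀ W inf_le_left).trans (hs W₀ W' inf_le_right).symm)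
  exact ⟨t, ht⟩

/-! ### Derivations on basic opens and their extension to vector fields. -/

section Derivations

variable {U W : X.Opens} (hU : IsAffineOpen U) (hW : IsBasicOpenOf U W)
include hU hW

theorem exists_derivation_res (d : Derivation ℂ Γ(X, U) Γ(X, U)) :
    ∃ d' : Derivation ℂ Γ(X, W) Γ(X, W), ∀ f, d' (res hW.le f) = res hW.le (d f) := by
  obtain ⟨g, hg⟩ := id hW
  let _ : Algebra Γ(X, U) Γ(X, W) := (res hW.le).toRingHom.toAlgebra
  have : IsScalarTower ℂ Γ(X, U) Γ(X, W) :=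
    IsScalarTower.of_algebraMap_eq fun c => ((res hW.le).commutes c).symm
  have : IsLocalization.Away g Γ(X, W) := hU.isLocalization_of_eq_basicOpen g (homOfLE hW.le) hg
  exact ((Algebra.linearMap Γ(X, U) Γ(X, W)).compDer d).exists_extend_localization (.powers g)

/-- A derivation `𝒪(W) → 𝒪(W')` along the restriction, where `W` is a basic open subset of `U`,
is determined by its values on functions on `U`. -/
theorem eq_of_leibniz {W' : X.Opens} (hW' : W' ≤ W) {δ δ' : Γ(X, W) →ₗ[ℂ] Γ(X, W')}
    (hδ : ∀ f g, δ (f * g) = res hW' f * δ g + res hW' g * δ f)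
    (hδ' : ∀ f g, δ' (f * g) = res hW' f * δ' g + res hW' g * δ' f)
    (h : ∀ f, δ (res hW.le f) = δ' (res hW.le f)) : δ = δ' := by
  obtain ⟨g, hg⟩ := id hW
  let _ : Algebra Γ(X, U) Γ(X, W) := (res hW.le).toRingHom.toAlgebra
  have : IsScalarTower ℂ Γ(X, U) Γ(X, W) :=
    IsScalarTower.of_algebraMap_eq fun c => ((res hW.le).commutes c).symm
  have : IsLocalization.Away g Γ(X, W) := hU.isLocalization_of_eq_basicOpen g (homOfLE hW.le) hg
  let _ : Algebra Γ(X, W) Γ(X, W') := (res hW').toRingHom.toAlgebra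
  have : IsScalarTower ℂ Γ(X, W) Γ(X, W') :=
    IsScalarTower.of_algebraMap_eq fun c => ((res hW').commutes c).symm
  have key := Derivation.eq_of_eq_on_algebraMap (Submonoid.powers g)
    (d := Derivation.mk' δ hδ) (d' := Derivation.mk' δ' hδ') h
  ext f
  exact DFunLike.congr_fun key f

/-- On functions coming from `U`, `d` factors through Ω, which the dxᵢ span; localization then
determines it on `W`. -/
theorem derivation_eq_zero {ι : Type*} {x : ι → Γ(X, U)}
    (hx : Submodule.span Γ(X, U) (Set.range fun i => KaehlerDifferential.D ℂ Γ(X, U) (x i)) = ⊤)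
    {d : Derivation ℂ Γ(X, W) Γ(X, W)} (hd : ∀ i, d (res hW.le (x i)) = 0) : d = 0 := by
  let _ : Algebra Γ(X, U) Γ(X, W) := (res hW.le).toRingHom.toAlgebra
  have : IsScalarTower ℂ Γ(X, U) Γ(X, W) :=
    IsScalarTower.of_algebraMap_eq fun c => ((res hW.le).commutes c).symm
  let d₀ : Derivation ℂ Γ(X, U) Γ(X, W) := d.compAlgebraMap Γ(X, U)
  have h₀ : d₀.liftKaehlerDifferential = 0 := by
    refine LinearMap.ext_on_range hx fun i => ?_
    rw [Derivation.liftKaehlerDifferential_comp_D]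
    exact hd i
  have key : (d : Γ(X, W) →ₗ[ℂ] Γ(X, W)) = 0 := by
    refine eq_of_leibniz hU hW le_rfl (fun f g => ?_) (fun f g => by simp) fun f => ?_
    · simp [res_refl]
    · have := LinearMap.congr_fun h₀ (KaehlerDifferential.D ℂ Γ(X, U) f)
      rw [Derivation.liftKaehlerDifferential_comp_D] at this
      exact this
  ext f
  exact LinearMap.congr_fun key f

end Derivations

/-- A derivation of `𝒪(U)`, `U` affine, extends to a vector field on `U`. -/
theorem exists_vectorField {U : X.Opens} (hU : IsAffineOpen U)
    (d : Derivation ℂ Γ(X, U) Γ(X, U)) :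
    ∃ D : SheafEnd U, IsVectorField D ∧
      ∀ V f, D.1 V (res V.2 f) = res V.2 (d f) := by
  choose dW hdW using fun W : {W : X.Opens // IsBasicOpenOf U W} =>
    exists_derivation_res hU W.2 d
  -- Both composites are derivations along the restriction and agree on functions from `U`.
  have hcomp (W W' : {W : X.Opens // IsBasicOpenOf U W}) (h : W.1 ≤ W'.1) (f : Γ(X, W'.1)) :
      res h (dW W' f) = dW W (res h f) := by
    refine LinearMap.congr_fun (f := (res h).toLinearMap ∘ₗ (dW W').toLinearMap)
      (g := (dW W).toLinearMap ∘ₗ (res h).toLinearMap) (eq_of_leibniz hU W'.2 h ?_ ?_ ?_) f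
    · intro f g
      simp
    · intro f g
      simp
    · intro f
      simp [hdW, res_res]
  have hglue (V : Set.Iic U) (s : Γ(X, V.1)) : ∃ t : Γ(X, V.1), ∀ W : BasicOpens U V.1,
      res W.2.2 t = dW ⟨W.1, W.2.1⟩ (res W.2.2 s) :=
    exists_gluing hU V.2 _ fun W W' h => by
      rw [hcomp ⟨W.1, W.2.1⟩ ⟨W'.1, W'.2.1⟩ h, res_res]
  choose P hP using hglue
  have hext {V : Set.Iic U} {s t : Γ(X, V.1)}
      (h : ∀ W : BasicOpens U V.1, res W.2.2 s = res W.2.2 t) : s = t := eq_of_res_eq hU V.2 h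
  refine ⟨⟨fun V => { toFun := P V, map_add' := ?_, map_smul' := ?_ }, ?_⟩, ?_, ?_⟩
  · exact fun f g => hext fun W => by simp [hP]
  · exact fun c f => hext fun W => by simp [hP]
  · intro V V' h f
    refine hext fun W => ?_
    change res W.2.2 (res h (P V f)) = res W.2.2 (P V' (res h f))
    rw [hP, res_res, res_res]
    exact hP V f ⟨W.1, W.2.1, W.2.2.trans h⟩
  · intro V f g
    refine hext fun W => ?_
    change res W.2.2 (P V (f * g)) = res W.2.2 (f * P V g + g * P V f)
    simp [hP]
  · intro V f
    refine hext fun W => ?_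
    change res W.2.2 (P V (res V.2 f)) = _
    have h (f : Γ(X, U)) : res W.2.2 (res V.2 f) = res W.2.1.le f := res_res _ _ f
    rw [hP, h, h]
    exact hdW ⟨W.1, W.2.1⟩ f

/-! ### Endomorphisms of the structure sheaf of an affine open. -/

section SheafEnd

variable {U : X.Opens} (hU : IsAffineOpen U)

theorem sheafEnd_ext {P Q : SheafEnd U} (h : ∀ V f, P.1 V f = Q.1 V f) : P = Q :=
  Subtype.ext (funext fun V => LinearMap.ext (h V))

include hU in
/-- Equality of endomorphisms of the structure sheaf of an affine open can be checked on basic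
open subsets. -/
theorem sheafEnd_ext_basicOpen {P Q : SheafEnd U}
    (h : ∀ (W : X.Opens) (hW : IsBasicOpenOf U W) (f : Γ(X, W)),
      P.1 ⟨W, hW.le⟩ f = Q.1 ⟨W, hW.le⟩ f) : P = Q := by
  refine sheafEnd_ext fun V f => eq_of_res_eq hU V.2 fun W => ?_
  rw [P.2 V ⟨W.1, W.2.1.le⟩ W.2.2, Q.2 V ⟨W.1, W.2.1.le⟩ W.2.2]
  exact h _ W.2.1 _

theorem mulOp_injective : Function.Injective (mulOp U) := fun a b h => by
  have := LinearMap.congr_fun (congrFun (congrArg Subtype.val h) ⟨U, Set.mem_Iic.2 le_rfl⟩) 1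
  change res le_rfl a * 1 = res le_rfl b * 1 at this
  simpa [res_refl] using this

variable {n : ℕ} {x : Fin n → Γ(X, U)}
  (hx : Submodule.span Γ(X, U) (Set.range fun i => KaehlerDifferential.D ℂ Γ(X, U) (x i)) = ⊤)
include hU hx

/-- On each basic open the bracket is a derivation killing the coordinates. -/
theorem lie_vectorField_eq_zero {P Q : SheafEnd U} (hP : IsVectorField P) (hQ : IsVectorField Q)
    (hPQ : ∀ V i, P.1 V (Q.1 V (res V.2 (x i))) = Q.1 V (P.1 V (res V.2 (x i)))) :
    ⁅P, Q⁆ = 0 := by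
  refine sheafEnd_ext_basicOpen hU fun W hW f => ?_
  let V : Set.Iic U := ⟨W, hW.le⟩
  let d : Derivation ℂ Γ(X, W) Γ(X, W) := ⁅Derivation.mk' (P.1 V) (hP V),
    Derivation.mk' (Q.1 V) (hQ V)⁆
  have hd : d = 0 := derivation_eq_zero hU hW hx fun i => sub_eq_zero.2 (hPQ V i)
  exact DFunLike.congr_fun hd f

/-- The function is P(1) on `U`: over each basic open, `P` multiplies by its value at 1, which is
the restriction of that function. -/
theorem mem_range_mulOp {m : ℕ} {P : SheafEnd U} (hP : P ∈ diffOp m U)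
    (hPx : ∀ i, ⁅P, mulOp U (x i)⁆ = 0) : P ∈ (mulOp U).range := by
  refine ⟨P.1 ⟨U, Set.mem_Iic.2 le_rfl⟩ 1, sheafEnd_ext_basicOpen hU fun W hW f => ?_⟩
  let V : Set.Iic U := ⟨W, hW.le⟩
  have h1 : IsDiffOp m (P.1 V) := hP V
  have h2 := h1.eq_mul_apply_one (fun d hd => derivation_eq_zero hU hW hx hd) (fun i g => by
    have := LinearMap.congr_fun (congrFun (congrArg Subtype.val (hPx i)) V) g
    exact sub_eq_zero.1 this) f
  have h3 : res hW.le (P.1 ⟨U, Set.mem_Iic.2 le_rfl⟩ 1) = P.1 V (res hW.le 1) :=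
    P.2 ⟨U, Set.mem_Iic.2 le_rfl⟩ V hW.le 1
  change res hW.le _ * f = P.1 V f
  rw [h3, map_one, mul_comm, h2]

omit hU hx in
theorem lie_mulOp_of_isVectorField {P : SheafEnd U} (hP : IsVectorField P) {a b : Γ(X, U)}
    (h : ∀ V, P.1 V (res V.2 a) = res V.2 b) : ⁅P, mulOp U a⁆ = mulOp U b := by
  refine sheafEnd_ext fun V f => ?_
  change P.1 V (res V.2 a * f) - res V.2 a * P.1 V f = res V.2 b * f
  rw [hP, h]
  ring

end SheafEnd

/-! ### From coordinates to the order filtration. -/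

theorem isWeylSystem_mulOp {U : X.Opens} {n : ℕ} {x : Fin n → Γ(X, U)} {D : Fin n → SheafEnd U}
    (hD : ∀ i j, ⁅D i, D j⁆ = 0) (hDx : ∀ i j, ⁅D i, mulOp U (x j)⁆ = if i = j then 1 else 0) :
    IsWeylSystem (mulOp U) x D where
  smul_eq _ _ := rfl
  comm i j := sub_eq_zero.1 (hD i j)
  lie_eq := hDx

theorem monomialSpan_eq_diffOp {U : X.Opens} (hU : IsAffineOpen U) {n : ℕ} {x : Fin n → Γ(X, U)}
    (hx : Submodule.span Γ(X, U)
      (Set.range fun i => KaehlerDifferential.D ℂ Γ(X, U) (x i)) = ⊤)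
    {D : Fin n → SheafEnd U} (hD : ∀ i, IsVectorField (D i))
    (h : IsWeylSystem (mulOp U) x D) (m : ℕ) : h.monomialSpan m = diffOp m U := by
  let _ : Algebra ℚ Γ(X, U) := Algebra.compHom _ (algebraMap ℚ ℂ)
  -- The order is defined by brackets with the function on the left, Weyl systems use the right;
  -- hence the sign.
  have hlie (P : SheafEnd U) (V : Set.Iic U) (a : Γ(X, U)) :
      ⁅P, mulOp U a⁆.1 V = -⁅LinearMap.mulLeft ℂ (res V.2 a), P.1 V⁆ :=
    (neg_sub _ _).symm
  refine h.monomialSpan_eq (F := fun m => diffOp m U) ?_ ?_ ?_ ?_ ?_ ?_ m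
  · exact fun m P hP V => IsDiffOp.succ (hP V)
  · exact fun V => isDiffOp_one
  · exact fun m P hP i V => IsDiffOp.mul_derivation (hP V) (hD i V)
  · intro P hP i
    refine Subtype.ext (funext fun V => ?_)
    rw [hlie, isDiffOp_zero_iff.1 (hP V), neg_zero]
    rfl
  · intro m P hP i V
    change IsDiffOp m _
    rw [hlie]
    exact (isDiffOp_succ_iff.1 (hP V) _).neg
  · exact fun m P hP hPx => mem_range_mulOp hU hx hP hPx

/-- Every point of a smooth variety has an affine open neighbourhood with étale coordinates. -/
theorem exists_affine_coordinates {n : ℕ} [hX : IsSmoothVariety X n] (p : X) :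
    ∃ U : X.Opens, IsAffineOpen U ∧ p ∈ U ∧ ∃ (x : Fin n → Γ(X, U))
      (d : Fin n → Derivation ℂ Γ(X, U) Γ(X, U)),
      Submodule.span Γ(X, U)
        (Set.range fun i => KaehlerDifferential.D ℂ Γ(X, U) (x i)) = ⊤ ∧
      ∀ i j, d i (x j) = if i = j then 1 else 0 := by
  obtain ⟨V, hV, hpV, hA⟩ := hX.exists_affine p
  let 𝔭 : Ideal Γ(X, V) :=
    (IsLocalRing.maximalIdeal (X.presheaf.stalk p)).comap (X.presheaf.germ V p hpV).hom
  have h𝔭 : 𝔭.IsPrime := Ideal.comap_isPrime _ _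
  -- `p` need not be closed, so coordinates are taken at a closed point specializing it; `f ∉ 𝔪`
  -- forces `f ∉ 𝔭`.
  obtain ⟨𝔪, h𝔪, hle⟩ := Ideal.exists_le_maximal 𝔭 h𝔭.ne_top
  obtain ⟨f, x, hf, hx, hli⟩ := hA.exists_coordinates 𝔪
  have hpf : p ∈ X.basicOpen f := by
    rw [X.mem_basicOpen f p hpV]
    by_contra hu
    exact hf (hle hu)
  have hUV : X.basicOpen f ≤ V := X.basicOpen_le f
  let _ : Algebra Γ(X, V) Γ(X, X.basicOpen f) := (res hUV).toRingHom.toAlgebra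
  have : IsScalarTower ℂ Γ(X, V) Γ(X, X.basicOpen f) :=
    IsScalarTower.of_algebraMap_eq fun c => ((res hUV).commutes c).symm
  have : IsLocalization.Away f Γ(X, X.basicOpen f) :=
    hV.isLocalization_of_eq_basicOpen f (homOfLE hUV) rfl
  obtain ⟨hsp, d, hd⟩ := exists_derivations_of_away (k := ℂ) (B := Γ(X, X.basicOpen f)) hx hli
  exact ⟨X.basicOpen f, hV.basicOpen f, hpf, _, d, hsp, hd⟩

end ComplexScheme

end

theorem mainTheorem8 (n : ℕ) (X : Scheme.{0}) [X.Over (Spec (CommRingCat.of ℂ))]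
    [ComplexScheme.IsSmoothVariety X n] (p : X) :
    ∃ U : X.Opens, IsAffineOpen U ∧ p ∈ U ∧
      ∃ (x : Fin n → Γ(X, U)) (D : Fin n → ComplexScheme.SheafEnd U),
        (∀ i, ComplexScheme.IsVectorField (D i)) ∧
        (∀ i j, ⁅D i, D j⁆ = 0) ∧
        (∀ i j, ⁅D i, ComplexScheme.mulOp U (x j)⁆ = if i = j then 1 else 0) ∧
        ∀ m : ℕ,
          LinearIndependent Γ(X, U)
            (fun α : {α : Fin n → ℕ // ∑ i, α i ≤ m} => ComplexScheme.monomialOp D α.1) ∧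
          Submodule.span Γ(X, U)
            (Set.range fun α : {α : Fin n → ℕ // ∑ i, α i ≤ m} =>
              ComplexScheme.monomialOp D α.1) = ComplexScheme.diffOp m U := by
  obtain ⟨U, hU, hpU, x, d, hx, hd⟩ := ComplexScheme.exists_affine_coordinates (n := n) p
  choose D hD hDd using fun i => ComplexScheme.exists_vectorField hU (d i)
  have hcomm (i j : Fin n) : ⁅D i, D j⁆ = 0 :=
    ComplexScheme.lie_vectorField_eq_zero hU hx (hD i) (hD j) fun V k => by
      -- Each `d i (x k)` is 0 or 1, so a second derivation kills it.
      simp only [hDd, hd]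
      split_ifs <;> simp
  have hDx (i j : Fin n) : ⁅D i, ComplexScheme.mulOp U (x j)⁆ = if i = j then 1 else 0 := by
    rw [ComplexScheme.lie_mulOp_of_isVectorField (hD i) (hDd i · (x j)), hd]
    split_ifs <;> simp
  have hW := ComplexScheme.isWeylSystem_mulOp hcomm hDx
  let _ : Algebra ℚ Γ(X, U) := Algebra.compHom _ (algebraMap ℚ ℂ)
  refine ⟨U, hU, hpU, x, D, hD, hcomm, hDx, fun m => ⟨?_, ?_⟩⟩
  · exact (hW.linearIndependent ComplexScheme.mulOp_injective).comp _ Subtype.val_injective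
  · exact ComplexScheme.monomialSpan_eq_diffOp hU hx hD hW m
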